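/- For a finite connected simple graph $G$ let $S(G)=\frac12\sum_{u}\sum_{v}(\deg u+\deg v)\,\mathrm{dis}(u,v)$ be its Schultz index, where $\mathrm{dis}$ is the graph distance. A cyclooctane chain $COC_n$ with $n\ge 1$ octagons is built as follows: $COC_1$ is an $8$-cycle $O_1$, and $COC_{n+1}$ arises from $COC_n$ by adding a new $8$-cycle $O_{n+1}$ with vertices $x_1,\dots,x_8$ in cyclic order and one edge that joins $x_1$ to a vertex $u_n$ of $O_n$. For $n\ge 2$, $u_n$ is one of the vertices $x_2,\dots,x_8$ of $O_n$, and there are four ways of attaching: $u_n\in\{x_2,x_8\}$, $u_n\in\{x_3,x_7\}$, $u_n\in\{x_4,x_6\}$, $u_n=x_5$; for $i=1,2,3,4$ let $Z_n^i$ be $1$ if the $i$-th way is used and $0$ otherwise. In a random cyclooctane chain the $u_n$ are random. Assume (Hypothesis 1) that the random vectors $(Z_n^1,Z_n^2,Z_n^3,Z_n^4)$, $n\ge 2$, are independent, with $\mathbb P(Z_n^i=1)=p_i$ and $\mathbb P(Z_n^i=0)=1-p_i$ for $i=1,2,3,4$, where $p_4=1-p_1-p_2-p_3$ and the $p_i$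 do not depend on $n$; and (Hypothesis 2) that $0<p_i<1$ for $i=1,2,3,4$. Then the following hold. (i) For every $n\ge 1$, $$\mathrm{Var}(S(COC_n))=\tfrac1{30}\Big(\sigma_2^2n^5-5r_2n^4+10\tilde\sigma_2^2n^3+(65r_2-30\sigma_2^2-45\tilde\sigma_2^2)n^2+(59\sigma_2^2+65\tilde\sigma_2^2-120r_2)n+(60r_2-30\sigma_2^2-30\tilde\sigma_2^2)\Big),$$ where $$\sigma_2^2=576^2p_1+864^2p_2+1152^2p_3+1440^2p_4-(576p_1+864p_2+1152p_3+1440p_4)^2,$$ $$\tilde\sigma_2^2=40^2p_1+328^2p_2+616^2p_3+904^2p_4-(40p_1+328p_2+616p_3+904p_4)^2,$$ $$r_2=576\cdot40\,p_1+864\cdot328\,p_2+1152\cdot616\,p_3+1440\cdot904\,p_4-(576p_1+864p_2+1152p_3+1440p_4)(40p_1+328p_2+616p_3+904p_4).$$ (ii) $S(COC_n)$ is asymptotically normal: $$\lim_{n\to\infty}\sup_{a\in\mathbb R}\left|\mathbb P\left(\frac{S(COC_n)-\mathbb E(S(COC_n))}{\sqrt{\mathrm{Var}(S(COC_n))}}\le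 a\right)-\int_{-\infty}^a\frac1{\sqrt{2\pi}}e^{-t^2/2}\,dt\right|=0.$$ -/

import Mathlib

open MeasureTheory ProbabilityTheory Filter
open scoped Topology

namespace CyclooctaneChain

noncomputable section

open Classical in
/-- The Schultz index `S(G) = (1/2) ∑_u ∑_v (deg u + deg v) dis(u, v)` of a finite graph. -/
def schultzIndex {V : Type*} [Fintype V] (G : SimpleGraph V) : ℝ :=
  (1 / 2 : ℝ) * ∑ u : V, ∑ v : V, ((G.degree u : ℝ) + (G.degree v : ℝ)) * (G.dist u v : ℝ)

/-- The cyclooctane chain with `n` octagons `O_1, …, O_n` and attaching sites `s 1, s 2, …`.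
The pair `(i, a)` stands for the vertex `x_{a+1}` of the octagon `O_{i+1}`, whose eight vertices
are labelled cyclically. Each octagon is an 8-cycle (addition in `Fin 8` is modulo 8), and for
`1 ≤ k < n` one further edge joins the vertex with label `s k` of `O_k` (the vertex `u_k`) to the
vertex `x_1` of `O_{k+1}`. -/
def chain (n : ℕ) (s : ℕ → Fin 8) : SimpleGraph (Fin n × Fin 8) :=
  SimpleGraph.fromRel fun v w =>
    (v.1 = w.1 ∧ w.2 = v.2 + 1) ∨
      ((v.1 : ℕ) + 1 = (w.1 : ℕ) ∧ v.2 = s (w.1 : ℕ) ∧ w.2 = 0)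

/-- The labels of the vertices of the last octagon (other than `x_1`) to which the new octagon is
attached in the four ways: `{x_2, x_8}`, `{x_3, x_7}`, `{x_4, x_6}`, `{x_5}`. -/
def attachingSites : Fin 4 → Finset (Fin 8) :=
  ![{1, 7}, {2, 6}, {3, 5}, {4}]

/-- The vector `(Z^1, Z^2, Z^3, Z^4)` of indicators of the way of attaching that is used when the
new octagon is attached at the vertex with label `a`. -/
def choiceIndicator (a : Fin 8) : Fin 4 → ℝ :=
  fun i => if a ∈ attachingSites i then 1 else 0

/-- `s k ω` is the label of the vertex of `O_k` to which `O_{k+1}` is attached. The chain that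
is built from `s` is a random cyclooctane chain with attaching probabilities `p` when, for `k ≥ 2`,
the new octagon is attached to a vertex other than `x_1`, the vectors `(Z_k^1, …, Z_k^4)`, `k ≥ 2`,
are independent random vectors, and `P(Z_k^i = 1) = p_i`, `P(Z_k^i = 0) = 1 - p_i`.
Nothing is asked about `s 1`, as the eight vertices of the first octagon are equivalent, and nothing
about which of two mirror-symmetric vertices is used. -/
structure IsRandomChain {Ω : Type*} [MeasurableSpace Ω] (P : Measure Ω)
    (s : ℕ → Ω → Fin 8) (p : Fin 4 → ℝ) : Prop where
  site_ne : ∀ k, 2 ≤ k → ∀ ω, s k ω ≠ 0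
  measurable_choice : ∀ k, 2 ≤ k → Measurable fun ω => choiceIndicator (s k ω)
  indep : iIndepFun (fun (j : ℕ) ω => choiceIndicator (s (j + 2) ω)) P
  prob_one : ∀ k, 2 ≤ k → ∀ i, P.real {ω | choiceIndicator (s k ω) i = 1} = p i
  prob_zero : ∀ k, 2 ≤ k → ∀ i, P.real {ω | choiceIndicator (s k ω) i = 0} = 1 - p i

/-- The random variable `S(COC_n)`. -/
def schultzChain {Ω : Type*} (s : ℕ → Ω → Fin 8) (n : ℕ) (ω : Ω) : ℝ :=
  schultzIndex (chain n fun k => s k ω)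

/-- The constant `σ₂²`. -/
def sigmaSq (p₁ p₂ p₃ : ℝ) : ℝ :=
  576 ^ 2 * p₁ + 864 ^ 2 * p₂ + 1152 ^ 2 * p₃ + 1440 ^ 2 * (1 - p₁ - p₂ - p₃)
    - (576 * p₁ + 864 * p₂ + 1152 * p₃ + 1440 * (1 - p₁ - p₂ - p₃)) ^ 2

/-- The constant `σ̃₂²`. -/
def sigmaTildeSq (p₁ p₂ p₃ : ℝ) : ℝ :=
  40 ^ 2 * p₁ + 328 ^ 2 * p₂ + 616 ^ 2 * p₃ + 904 ^ 2 * (1 - p₁ - p₂ - p₃)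
    - (40 * p₁ + 328 * p₂ + 616 * p₃ + 904 * (1 - p₁ - p₂ - p₃)) ^ 2

/-- The constant `r₂`. -/
def rConst (p₁ p₂ p₃ : ℝ) : ℝ :=
  -((576 * p₁ + 864 * p₂ + 1152 * p₃ + 1440 * (1 - p₁ - p₂ - p₃))
      * (40 * p₁ + 328 * p₂ + 616 * p₃ + 904 * (1 - p₁ - p₂ - p₃)))
    + 576 * 40 * p₁ + 864 * 328 * p₂ + 1152 * 616 * p₃ + 1440 * 904 * (1 - p₁ - p₂ - p₃)

end

end CyclooctaneChain

/-! The octagons are strung together by bridges, so a distance between different octagons is a sum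
of distances across the octagons on the way. By symmetry of the distance, `S = ∑ u, deg u * ∑ v,
dis(u, v)`. Collected by pairs of octagons (`schultzIndex_chain`), the index of the chain with `N +
1` octagons is a constant plus `∑ 288 (k + 1) (N - 1 - k) D_k`, where `D_k`, for `k < N - 1`, is the
distance between the two attaching vertices of `O_{k+2}`, an octagon that separates `k + 1` octagons
from `N - 1 - k` others.

The `D_k` are independent with `P(D_k = i) = p_i`, so the variance is `Var(D)` times the sum of the
squared weights, that is `288² Var(D) (N⁵ - N) / 30`. The coefficients 576, 864, … and 40, 328, …
are `288 i + 288` and `288 i - 248`, so the three constants of the statement all equal `288² Var(D)`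
and its polynomial collapses to this one.

For (ii), the normalized weights are `O(N^(-1/2))` uniformly, and `tendsto_charFun_weighted_sum`
compares the characteristic function with the Gaussian one factor by factor. Lévy's continuity
theorem gives weak convergence, and Pólya's theorem (`tendsto_iSup_abs_sub_of_tendsto`) makes the
convergence of distribution functions uniform. -/

/-! ### Graph distance from a potential -/

namespace SimpleGraph

/-- A function on the vertices that vanishes at `u`, grows by at most one along each edge and
decreases by one along some edge at every other vertex is the distance from `u`. -/
theorem dist_eq_of_potential {V : Type*} {G : SimpleGraph V} {u : V} (D : V → ℕ) (hu : D u = 0)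
    (hstep : ∀ v w, G.Adj v w → D w ≤ D v + 1)
    (hdesc : ∀ v, v ≠ u → ∃ w, G.Adj v w ∧ D w + 1 = D v) (v : V) : G.dist u v = D v := by
  have hlow : ∀ {x y : V} (q : G.Walk x y), D y ≤ D x + q.length := by
    intro x y q
    induction q with
    | nil => simp
    | cons h q ih =>
      have := hstep _ _ h
      simp only [Walk.length_cons]
      omega
  have hup : ∀ k, ∀ v, D v = k → ∃ q : G.Walk v u, q.length = k := by
    intro k
    induction k with
    | zero =>
      intro v hv
      by_cases h : v = u
      · subst h
        exact ⟨Walk.nil, rfl⟩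
      · obtain ⟨w, -, hw⟩ := hdesc v h
        omega
    | succ k ih =>
      intro v hv
      have h : v ≠ u := by
        rintro rfl
        omega
      obtain ⟨w, hvw, hw⟩ := hdesc v h
      obtain ⟨q, hq⟩ := ih w (by omega)
      exact ⟨Walk.cons hvw q, by simp [hq]⟩
  obtain ⟨q, hq⟩ := hup _ v rfl
  -- The walk `q` is needed for reachability as well: between unreachable vertices `dist` is 0 by
  -- default.
  obtain ⟨r, hr⟩ := (Walk.reachable q.reverse).exists_walk_length_eq_dist
  have h1 := hlow r
  have h2 := dist_le q.reverse
  rw [Walk.length_reverse] at h2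
  omega

end SimpleGraph

/-! ### Distances and degrees in the chain -/

namespace CyclooctaneChain

/-- The distance between two vertices of the 8-cycle. -/
def cycDist (a b : Fin 8) : ℕ := min (a - b).val (b - a).val

theorem cycDist_self (a : Fin 8) : cycDist a a = 0 := by simp [cycDist]

theorem cycDist_comm (a b : Fin 8) : cycDist a b = cycDist b a := by
  simp [cycDist, min_comm]

theorem cycDist_add_one_le (a b : Fin 8) : cycDist a (b + 1) ≤ cycDist a b + 1 := by
  revert a b; decide

theorem cycDist_le_add_one (a b : Fin 8) : cycDist a b ≤ cycDist a (b + 1) + 1 := by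
  revert a b; decide

theorem exists_cycDist_descent (a b : Fin 8) (h : b ≠ a) :
    cycDist a (b + 1) + 1 = cycDist a b ∨ cycDist a (b - 1) + 1 = cycDist a b := by
  revert a b; decide

theorem sum_cycDist (a : Fin 8) : ∑ b, cycDist a b = 16 := by
  revert a; decide

/-- The vertex of the octagon with index `j` that is nearest to the vertex `(i, a)`. -/
def port (s : ℕ → Fin 8) (i : ℕ) (a : Fin 8) (j : ℕ) : Fin 8 :=
  if i = j then a else if i < j then 0 else s (j + 1)

/-- The distance from the vertex `(i, a)` to the octagon with index `j`. -/
def entryDist (s : ℕ → Fin 8) (i : ℕ) (a : Fin 8) (j : ℕ) : ℕ :=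
  if i = j then 0
  else if i < j then
    cycDist a (s (i + 1)) + 1 + ∑ m ∈ Finset.Ico (i + 1) j, (cycDist 0 (s (m + 1)) + 1)
  else cycDist a 0 + 1 + ∑ m ∈ Finset.Ico (j + 1) i, (cycDist 0 (s (m + 1)) + 1)

/-- The distance between the vertices `(i, a)` and `(j, b)` of the chain. -/
def chainDist (s : ℕ → Fin 8) (i : ℕ) (a : Fin 8) (j : ℕ) (b : Fin 8) : ℕ :=
  entryDist s i a j + cycDist (port s i a j) b

/-- Along a bridge the potential changes by exactly one. The sign depends on which side of the
bridge the starting octagon lies; the next lemma is the other case. -/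
theorem chainDist_link_of_le (s : ℕ → Fin 8) {i j : ℕ} (a : Fin 8) (h : i ≤ j) :
    chainDist s i a (j + 1) 0 = chainDist s i a j (s (j + 1)) + 1 := by
  rcases h.eq_or_lt with rfl | h
  · simp [chainDist, entryDist, port, cycDist_self]
  · simp only [chainDist, entryDist, port, h, h.ne, h.trans (Nat.lt_succ_self j),
      (h.trans (Nat.lt_succ_self j)).ne, if_true, if_false, cycDist_self]
    rw [Finset.sum_Ico_succ_top (by omega)]
    omega

theorem chainDist_link_of_lt (s : ℕ → Fin 8) {i j : ℕ} (a : Fin 8) (h : j < i) :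
    chainDist s i a j (s (j + 1)) = chainDist s i a (j + 1) 0 + 1 := by
  rcases (show j + 1 ≤ i from h).eq_or_lt with h' | h'
  · subst h'
    simp [chainDist, entryDist, port, cycDist_self]
  · have h1 : ¬ i < j := by omega
    have h2 : i ≠ j := by omega
    have h3 : ¬ i < j + 1 := by omega
    have h4 : i ≠ j + 1 := by omega
    simp only [chainDist, entryDist, port, h1, h2, h3, h4, if_false, cycDist_self]
    rw [Finset.sum_eq_sum_Ico_succ_bot h', cycDist_comm (s (j + 1 + 1)) 0]
    omega

theorem chain_adj {n : ℕ} {s : ℕ → Fin 8} {v w : Fin n × Fin 8} :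
    (chain n s).Adj v w ↔
      (v.1 = w.1 ∧ (w.2 = v.2 + 1 ∨ v.2 = w.2 + 1)) ∨
      ((v.1 : ℕ) + 1 = (w.1 : ℕ) ∧ v.2 = s (w.1 : ℕ) ∧ w.2 = 0) ∨
      ((w.1 : ℕ) + 1 = (v.1 : ℕ) ∧ w.2 = s (v.1 : ℕ) ∧ v.2 = 0) := by
  have hne : ∀ a : Fin 8, a ≠ a + 1 := by decide
  rw [chain, SimpleGraph.fromRel_adj]
  constructor
  · rintro ⟨-, (⟨h1, h2⟩ | h) | (⟨h1, h2⟩ | h)⟩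
    · exact .inl ⟨h1, .inl h2⟩
    · exact .inr (.inl h)
    · exact .inl ⟨h1.symm, .inr h2⟩
    · exact .inr (.inr h)
  · rintro (⟨h1, h2 | h2⟩ | h | h)
    · exact ⟨fun h => hne v.2 (by rw [← h2, h]), .inl (.inl ⟨h1, h2⟩)⟩
    · exact ⟨fun h => hne w.2 (by rw [← h2, h]), .inr (.inl ⟨h1.symm, h2⟩)⟩
    · exact ⟨fun e => by rw [e] at h; omega, .inl (.inr h)⟩
    · exact ⟨fun e => by rw [e] at h; omega, .inr (.inr h)⟩

/-- `chainDist` is a potential. At a vertex other than the port it descends around the octagon; at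
the port it descends across the bridge towards octagon `i`. -/
theorem chain_dist {n : ℕ} (s : ℕ → Fin 8) (u v : Fin n × Fin 8) :
    (chain n s).dist u v = chainDist s u.1 u.2 v.1 v.2 := by
  obtain ⟨i, a⟩ := u
  refine SimpleGraph.dist_eq_of_potential (fun v => chainDist s i a v.1 v.2) ?_ ?_ ?_ v
  · simp [chainDist, entryDist, port, cycDist_self]
  · rintro ⟨j, b⟩ ⟨k, c⟩ h
    rw [chain_adj] at h
    dsimp only at h ⊢
    rcases h with ⟨rfl, rfl | rfl⟩ | ⟨h1, rfl, rfl⟩ | ⟨h1, rfl, rfl⟩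
    · have := cycDist_add_one_le (port s i a j) b
      simp only [chainDist]
      omega
    · have := cycDist_le_add_one (port s i a j) c
      simp only [chainDist]
      omega
    · rw [← h1]
      rcases le_or_gt (i : ℕ) j with h | h
      · rw [chainDist_link_of_le s a h]
      · rw [chainDist_link_of_lt s a h]
        omega
    · rw [← h1]
      rcases le_or_gt (i : ℕ) k with h | h
      · rw [chainDist_link_of_le s a h]
        omega
      · rw [chainDist_link_of_lt s a h]
  · rintro ⟨j, b⟩ hne
    dsimp only
    by_cases hb : b = port s i a j
    · rcases lt_trichotomy (i : ℕ) j with h | h | h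
      · obtain ⟨k, hk⟩ : ∃ k, (j : ℕ) = k + 1 := ⟨j - 1, by omega⟩
        have hb0 : b = 0 := by rw [hb, port, if_neg h.ne, if_pos h]
        refine ⟨(⟨k, by omega⟩, s j), ?_, ?_⟩
        · rw [chain_adj]
          exact .inr (.inr ⟨hk.symm, rfl, hb0⟩)
        · dsimp only
          rw [hb0, hk, chainDist_link_of_le s a (by omega)]
      · exfalso
        apply hne
        have hij : j = i := Fin.ext h.symm
        subst hij
        rw [hb]
        simp [port]
      · have hbs : b = s (j + 1) := by rw [hb, port, if_neg h.ne', if_neg (by omega)]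
        refine ⟨(⟨j + 1, by omega⟩, 0), ?_, ?_⟩
        · rw [chain_adj]
          exact .inr (.inl ⟨rfl, hbs, rfl⟩)
        · dsimp only
          rw [hbs, chainDist_link_of_lt s a h]
    · rcases exists_cycDist_descent _ _ hb with h | h
      · refine ⟨(j, b + 1), chain_adj.2 (.inl ⟨rfl, .inl rfl⟩), ?_⟩
        simp only [chainDist]
        omega
      · refine ⟨(j, b - 1), chain_adj.2 (.inl ⟨rfl, .inr (by simp)⟩), ?_⟩
        simp only [chainDist]
        omega

-- The two bridge terms add up because bridges lead to different octagons. The sites are arbitrary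
-- here, so both terms may occur at the same vertex.
open Classical in
theorem chain_degree {n : ℕ} (s : ℕ → Fin 8) (i : Fin n) (a : Fin 8) :
    (chain n s).degree (i, a) = 2 + (if 0 < (i : ℕ) ∧ a = 0 then 1 else 0) +
      (if (i : ℕ) + 1 < n ∧ a = s (i + 1) then 1 else 0) := by
  have e : (chain n s).neighborFinset (i, a) =
      (({(i, a + 1), (i, a - 1)} : Finset (Fin n × Fin 8)) ∪
        (if 0 < (i : ℕ) ∧ a = 0 then {(⟨i - 1, by omega⟩, s i)} else ∅)) ∪
        (if h : (i : ℕ) + 1 < n ∧ a = s (i + 1) then {(⟨i + 1, h.1⟩, 0)} else ∅) := by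
    ext ⟨j, b⟩
    rw [SimpleGraph.mem_neighborFinset, chain_adj]
    have h1 : a = b + 1 ↔ b = a - 1 := by rw [eq_sub_iff_add_eq, eq_comm]
    simp only [Finset.mem_union, Finset.mem_insert, Finset.mem_singleton, Prod.mk.injEq]
    constructor
    · rintro (⟨rfl, h | h⟩ | ⟨h, h2, h3⟩ | ⟨h, h2, h3⟩)
      · exact .inl (.inl (.inl ⟨rfl, h⟩))
      · exact .inl (.inl (.inr ⟨rfl, h1.1 h⟩))
      · right
        rw [dif_pos ⟨by omega, by rw [h]; exact h2⟩]
        simp [h, h3]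
      · left; right
        rw [if_pos ⟨by omega, h3⟩]
        simp only [Finset.mem_singleton, Prod.mk.injEq, Fin.ext_iff]
        exact ⟨by omega, by rw [h2]⟩
    · rintro (((⟨rfl, h⟩ | ⟨rfl, h⟩) | h) | h)
      · exact .inl ⟨rfl, .inl h⟩
      · exact .inl ⟨rfl, .inr (h1.2 h)⟩
      · split_ifs at h with hc
        · simp only [Finset.mem_singleton, Prod.mk.injEq, Fin.ext_iff] at h
          exact .inr (.inr ⟨by omega, Fin.ext h.2, hc.2⟩)
        · simp at h
      · split_ifs at h with hc
        · simp only [Finset.mem_singleton, Prod.mk.injEq, Fin.ext_iff] at h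
          exact .inr (.inl ⟨by omega, by rw [h.1]; exact hc.2, Fin.ext h.2⟩)
        · simp at h
  have hne : ∀ a : Fin 8, a + 1 ≠ a - 1 := by decide
  rw [← SimpleGraph.card_neighborFinset_eq_degree, e, Finset.card_union_of_disjoint,
    Finset.card_union_of_disjoint, Finset.card_pair]
  · split_ifs <;> simp
  · simp [hne]
  · split_ifs with h
    · simp [Fin.ext_iff]
      omega
    · simp
  · split_ifs with h h' h'
    · simp [Fin.ext_iff]
      omega
    · simp
    · simp [Fin.ext_iff]
    · simp

end CyclooctaneChain

/-! ### The Schultz index as an affine function of the attaching distances -/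

theorem Finset.sum_range_sum_range_eq_diag_add {M : Type*} [AddCommMonoid M] (n : ℕ)
    (q : ℕ → ℕ → M) :
    ∑ i ∈ Finset.range n, ∑ j ∈ Finset.range n, q i j =
      ∑ i ∈ Finset.range n, q i i +
        ∑ j ∈ Finset.range n, ∑ i ∈ Finset.range j, (q i j + q j i) := by
  induction n with
  | zero => simp
  | succ n ih =>
    simp only [Finset.sum_range_succ, Finset.sum_add_distrib] at ih ⊢
    rw [ih]
    abel

namespace CyclooctaneChain

theorem sum_degree_mul {n : ℕ} (s : ℕ → Fin 8) (f : ℕ → Fin 8 → ℝ)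
    [∀ v, Fintype ((chain n s).neighborSet v)] :
    ∑ v : Fin n × Fin 8, ((chain n s).degree v : ℝ) * f v.1 v.2 =
      ∑ i ∈ Finset.range n, (2 * ∑ a, f i a + (if 0 < i then f i 0 else 0) +
        (if i + 1 < n then f i (s (i + 1)) else 0)) := by
  rw [Fintype.sum_prod_type, Finset.sum_range]
  refine Finset.sum_congr rfl fun i _ => ?_
  have h : ∀ a, ((chain n s).degree (i, a) : ℝ) * f i a =
      2 * f i a + (if a = 0 then (if 0 < (i : ℕ) then f i a else 0) else 0) +
        (if a = s (i + 1) then (if (i : ℕ) + 1 < n then f i a else 0) else 0) := by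
    intro a
    have := chain_degree s i a
    -- Passage from the classical instance of `chain_degree` to the given one.
    have e : (chain n s).degree (i, a) = 2 + (if 0 < (i : ℕ) ∧ a = 0 then 1 else 0) +
        (if (i : ℕ) + 1 < n ∧ a = s (i + 1) then 1 else 0) := by
      rw [← this]
      congr!
    rw [e]
    split_ifs <;> first | (exfalso; tauto) | (push_cast; ring)
  simp only [h, Finset.sum_add_distrib, ← Finset.mul_sum, Finset.sum_ite_eq', Finset.mem_univ,
    if_true]

/-- The contribution of the vertices of the octagons with indices `i` and `j` to
`∑ u, deg u * ∑ v, dis(u, v)`, where `u` lies in the first and `v` in the second octagon. -/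
def pairTerm (n : ℕ) (s : ℕ → Fin 8) (i j : ℕ) : ℝ :=
  2 * ∑ a, (8 * (entryDist s i a j : ℝ) + 16) +
    (if 0 < i then 8 * (entryDist s i 0 j : ℝ) + 16 else 0) +
    (if i + 1 < n then 8 * (entryDist s i (s (i + 1)) j : ℝ) + 16 else 0)

theorem schultzIndex_eq_sum_dist {V : Type*} [Fintype V] (G : SimpleGraph V)
    [∀ v, Fintype (G.neighborSet v)] :
    schultzIndex G = ∑ u, (G.degree u : ℝ) * ∑ v, (G.dist u v : ℝ) := by
  have h : ∑ u : V, ∑ v : V, (G.degree v : ℝ) * (G.dist u v : ℝ) =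
      ∑ u : V, ∑ v : V, (G.degree u : ℝ) * (G.dist u v : ℝ) := by
    rw [Finset.sum_comm]
    refine Finset.sum_congr rfl fun u _ => Finset.sum_congr rfl fun v _ => ?_
    rw [G.dist_comm]
  have e : schultzIndex G =
      1 / 2 * ∑ u : V, ∑ v : V, ((G.degree u : ℝ) + (G.degree v : ℝ)) * (G.dist u v : ℝ) := by
    unfold schultzIndex
    congr!
  rw [e]
  simp only [add_mul, Finset.sum_add_distrib]
  rw [h]
  simp only [Finset.mul_sum]
  ring

/-- Whatever the port is, the distances from it within its octagon sum to 16; hence `8 * entryDist +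
16`. -/
theorem schultzIndex_chain_eq_sum_pairTerm (n : ℕ) (s : ℕ → Fin 8) :
    schultzIndex (chain n s) =
      ∑ i ∈ Finset.range n, ∑ j ∈ Finset.range n, pairTerm n s i j := by
  classical
  have h : ∀ u : Fin n × Fin 8, ∑ v, ((chain n s).dist u v : ℝ) =
      ∑ j ∈ Finset.range n, (8 * (entryDist s u.1 u.2 j : ℝ) + 16) := by
    intro u
    rw [Fintype.sum_prod_type, Finset.sum_range]
    refine Finset.sum_congr rfl fun j _ => ?_
    have := sum_cycDist (port s u.1 u.2 j)
    simp only [chain_dist, chainDist, Nat.cast_add, Finset.sum_add_distrib]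
    rw [← Nat.cast_sum, ← Nat.cast_sum, this]
    simp
  rw [schultzIndex_eq_sum_dist]
  simp only [h]
  rw [sum_degree_mul s fun i a => ∑ j ∈ Finset.range n, (8 * (entryDist s i a j : ℝ) + 16)]
  refine Finset.sum_congr rfl fun i _ => ?_
  simp only [pairTerm, Finset.sum_add_distrib, ← Finset.mul_sum]
  congr 1
  · congr 1
    · rw [Finset.sum_comm]
      simp only [Finset.sum_const, Finset.card_univ, Fintype.card_fin, nsmul_eq_mul,
        Finset.card_range]
      ring
    · split_ifs <;> simp [Finset.sum_add_distrib, Finset.mul_sum]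
  · split_ifs <;> simp [Finset.sum_add_distrib, Finset.mul_sum]

/-- The distance between the two attaching vertices of the octagon with index `m`. -/
def siteDist (s : ℕ → Fin 8) (m : ℕ) : ℝ := cycDist 0 (s (m + 1))

theorem sum_Ico_siteDist (s : ℕ → Fin 8) {i j : ℕ} (h : i < j) :
    ((∑ m ∈ Finset.Ico (i + 1) j, (cycDist 0 (s (m + 1)) + 1) : ℕ) : ℝ) =
      (∑ m ∈ Finset.range j, siteDist s m - ∑ m ∈ Finset.range (i + 1), siteDist s m) +
        ((j : ℝ) - i - 1) := by
  rw [← Finset.sum_Ico_eq_sub _ (show i + 1 ≤ j from h)]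
  push_cast
  rw [Finset.sum_add_distrib, Finset.sum_const, Nat.card_Ico, nsmul_eq_mul,
    Nat.cast_sub (show i + 1 ≤ j from h)]
  simp only [siteDist]
  push_cast
  ring

theorem entryDist_of_lt (s : ℕ → Fin 8) (a : Fin 8) {i j : ℕ} (h : i < j) :
    (entryDist s i a j : ℝ) = cycDist a (s (i + 1)) + 1 +
      ((∑ m ∈ Finset.range j, siteDist s m - ∑ m ∈ Finset.range (i + 1), siteDist s m) +
        ((j : ℝ) - i - 1)) := by
  rw [← sum_Ico_siteDist s h, entryDist, if_neg h.ne, if_pos h]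
  push_cast
  rfl

theorem entryDist_of_gt (s : ℕ → Fin 8) (a : Fin 8) {i j : ℕ} (h : j < i) :
    (entryDist s i a j : ℝ) = cycDist a 0 + 1 +
      ((∑ m ∈ Finset.range i, siteDist s m - ∑ m ∈ Finset.range (j + 1), siteDist s m) +
        ((i : ℝ) - j - 1)) := by
  rw [← sum_Ico_siteDist s h, entryDist, if_neg h.ne', if_neg h.not_gt]
  push_cast
  rfl

theorem pairTerm_self (n : ℕ) (s : ℕ → Fin 8) (i : ℕ) :
    pairTerm n s i i = 256 + (if 0 < i then 16 else 0) + (if i + 1 < n then 16 else 0) := by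
  simp [pairTerm, entryDist]
  norm_num

theorem sum_cycDist_left (b : Fin 8) : ∑ a, (cycDist a b : ℝ) = 16 := by
  have := sum_cycDist b
  simp only [cycDist_comm b] at this
  exact_mod_cast this

/-- The degrees in an octagon sum to 16 plus its number of bridges. The bridge towards the other
octagon always exists, whence `272 = 2 * 8 * 17`. A bridge pointing away adds 1, at a vertex that
lies `siteDist` further off. -/
theorem pairTerm_add_pairTerm {n : ℕ} (s : ℕ → Fin 8) {i j : ℕ} (hij : i < j) (hj : j < n) :
    pairTerm n s i j + pairTerm n s j i =
      (1328 + 272 * ((j : ℝ) - i - 1) + (if 0 < i then 24 + 8 * ((j : ℝ) - i - 1) else 0) +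
        (if j + 1 < n then 24 + 8 * ((j : ℝ) - i - 1) else 0)) +
      (272 * (∑ m ∈ Finset.range j, siteDist s m - ∑ m ∈ Finset.range (i + 1), siteDist s m) +
        (if 0 < i then 8 * (siteDist s i + (∑ m ∈ Finset.range j, siteDist s m -
          ∑ m ∈ Finset.range (i + 1), siteDist s m)) else 0) +
        (if j + 1 < n then 8 * (siteDist s j + (∑ m ∈ Finset.range j, siteDist s m -
          ∑ m ∈ Finset.range (i + 1), siteDist s m)) else 0)) := by
  have h1 : 0 < j := by omega
  have h2 : i + 1 < n := by omega
  have h3 : (cycDist 0 (s (i + 1)) : ℝ) = siteDist s i := rfl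
  have h4 : (cycDist (s (j + 1)) 0 : ℝ) = siteDist s j := by rw [cycDist_comm]; rfl
  simp only [pairTerm, entryDist_of_lt s _ hij, entryDist_of_gt s _ hij, h1, h2, if_true,
    cycDist_self, h3, h4, Finset.sum_add_distrib, ← Finset.mul_sum, sum_cycDist_left]
  simp only [Finset.sum_const, Finset.card_univ, Fintype.card_fin, nsmul_eq_mul]
  by_cases h5 : 0 < i <;> by_cases h6 : j + 1 < n <;> simp only [h5, h6, if_true, if_false] <;>
    push_cast <;> ring

/-- The term `b m` is counted once for each `i < m`. -/
theorem sum_range_sub_sum_range (b : ℕ → ℝ) (n : ℕ) :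
    ∑ i ∈ Finset.range n, (∑ m ∈ Finset.range n, b m - ∑ m ∈ Finset.range (i + 1), b m) =
      ∑ m ∈ Finset.range n, (m : ℝ) * b m := by
  induction n with
  | zero => simp
  | succ n ih =>
    rw [Finset.sum_range_succ, Finset.sum_range_succ (fun m => (m : ℝ) * b m), ← ih, sub_self,
      add_zero, Finset.sum_range_succ b n]
    simp only [Finset.sum_sub_distrib, Finset.sum_const, Finset.card_range, nsmul_eq_mul]
    ring

/-- Octagon `m` lies strictly between `m * (N - m)` pairs. A pair of inner octagons has weight `288
= 2 * 8 * 18`; the end octagons lack one bridge, and the extra terms `8 * b i`, `8 * b j` make up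
for exactly that. -/
theorem sum_pairs_eq (b : ℕ → ℝ) (N : ℕ) :
    ∑ j ∈ Finset.range (N + 1), ∑ i ∈ Finset.range j,
      (272 * (∑ m ∈ Finset.range j, b m - ∑ m ∈ Finset.range (i + 1), b m) +
        (if 0 < i then 8 * (b i + (∑ m ∈ Finset.range j, b m -
          ∑ m ∈ Finset.range (i + 1), b m)) else 0) +
        (if j + 1 < N + 1 then 8 * (b j + (∑ m ∈ Finset.range j, b m -
          ∑ m ∈ Finset.range (i + 1), b m)) else 0)) =
      288 * ∑ m ∈ Finset.range (N + 1), (m : ℝ) * ((N : ℝ) - m) * b m := by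
  -- The omitted term `i = 0` would be 8 times the full sum of `b` below `j`, which cancels the
  -- total of the `8 * b i`.
  have hx : ∀ j, ∑ i ∈ Finset.range j, (if 0 < i then 8 * (b i + (∑ m ∈ Finset.range j, b m -
      ∑ m ∈ Finset.range (i + 1), b m)) else 0) =
      8 * ∑ i ∈ Finset.range j, (∑ m ∈ Finset.range j, b m -
        ∑ m ∈ Finset.range (i + 1), b m) := by
    intro j
    rcases j with _ | k
    · simp
    · have e : ∑ i ∈ Finset.range (k + 1), (8 * (b i + (∑ m ∈ Finset.range (k + 1), b m -
          ∑ m ∈ Finset.range (i + 1), b m))) =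
          8 * (∑ m ∈ Finset.range (k + 1), b m) + 8 * ∑ i ∈ Finset.range (k + 1),
          (∑ m ∈ Finset.range (k + 1), b m - ∑ m ∈ Finset.range (i + 1), b m) := by
        rw [← Finset.mul_sum, Finset.sum_add_distrib, mul_add]
      rw [Finset.sum_range_succ'] at e ⊢
      simp only [Nat.succ_pos, if_true, lt_irrefl, if_false, add_zero, zero_add,
        Finset.sum_range_one] at e ⊢
      linarith
  have hy : ∑ j ∈ Finset.range (N + 1), ∑ i ∈ Finset.range j,
      (if j + 1 < N + 1 then 8 * (b j + (∑ m ∈ Finset.range j, b m -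
        ∑ m ∈ Finset.range (i + 1), b m)) else 0) =
      8 * ∑ j ∈ Finset.range N, ∑ i ∈ Finset.range (j + 1), (∑ m ∈ Finset.range (j + 1), b m -
        ∑ m ∈ Finset.range (i + 1), b m) := by
    rw [Finset.sum_range_succ]
    simp only [lt_irrefl, if_false, Finset.sum_const_zero, add_zero]
    rw [Finset.mul_sum]
    refine Finset.sum_congr rfl fun j hj => ?_
    have : j + 1 < N + 1 := by simpa using hj
    simp only [this, if_true]
    -- Adding `b j` extends the inner range to `j + 1`; the new term `i = j` is zero.
    rw [Finset.sum_range_succ _ j, sub_self, add_zero, Finset.mul_sum]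
    refine Finset.sum_congr rfl fun i _ => ?_
    rw [Finset.sum_range_succ b j]
    ring
  simp only [Finset.sum_add_distrib]
  rw [hy]
  simp only [hx, ← Finset.mul_sum, sum_range_sub_sum_range]
  clear hx hy
  induction N with
  | zero => simp
  | succ N ih =>
    have e : ∑ m ∈ Finset.range (N + 1 + 1), (m : ℝ) * (((N + 1 : ℕ) : ℝ) - m) * b m =
        ∑ m ∈ Finset.range (N + 1), (m : ℝ) * ((N : ℝ) - m) * b m +
          ∑ m ∈ Finset.range (N + 1), (m : ℝ) * b m := by
      rw [Finset.sum_range_succ _ (N + 1), sub_self, mul_zero, zero_mul, add_zero,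
        ← Finset.sum_add_distrib]
      refine Finset.sum_congr rfl fun m _ => ?_
      push_cast
      ring
    rw [e, Finset.sum_range_succ _ (N + 1),
      Finset.sum_range_succ (fun x => ∑ m ∈ Finset.range (x + 1), (m : ℝ) * b m) N]
    linarith

/-- The part of the Schultz index of the chain that does not depend on the attaching sites. -/
def schultzConst (n : ℕ) : ℝ :=
  ∑ i ∈ Finset.range n, (256 + (if 0 < i then 16 else 0) + (if i + 1 < n then 16 else 0)) +
  ∑ j ∈ Finset.range n, ∑ i ∈ Finset.range j,
    (1328 + 272 * ((j : ℝ) - i - 1) + (if 0 < i then 24 + 8 * ((j : ℝ) - i - 1) else 0) +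
      (if j + 1 < n then 24 + 8 * ((j : ℝ) - i - 1) else 0))

/-- The first octagon has weight 0, so the index is shifted by one; the term `m = N - 1`, for the
last octagon, also vanishes. -/
theorem schultzIndex_chain (N : ℕ) (s : ℕ → Fin 8) :
    schultzIndex (chain (N + 1) s) = schultzConst (N + 1) +
      ∑ m ∈ Finset.range N, 288 * (((m : ℝ) + 1) * ((N : ℝ) - 1 - m)) * siteDist s (m + 1) := by
  have e : ∑ m ∈ Finset.range N, 288 * (((m : ℝ) + 1) * ((N : ℝ) - 1 - m)) * siteDist s (m + 1) =
      288 * ∑ m ∈ Finset.range (N + 1), (m : ℝ) * ((N : ℝ) - m) * siteDist s m := by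
    rw [Finset.sum_range_succ', Nat.cast_zero, zero_mul, zero_mul, add_zero, Finset.mul_sum]
    refine Finset.sum_congr rfl fun m _ => ?_
    push_cast
    ring
  rw [e, ← sum_pairs_eq, schultzIndex_chain_eq_sum_pairTerm, schultzConst,
    Finset.sum_range_sum_range_eq_diag_add, add_assoc]
  simp only [pairTerm_self]
  congr 1
  rw [← Finset.sum_add_distrib]
  refine Finset.sum_congr rfl fun j hj => ?_
  rw [← Finset.sum_add_distrib]
  refine Finset.sum_congr rfl fun i hi => ?_
  exact pairTerm_add_pairTerm s (by simpa using hi) (by simpa using hj)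

end CyclooctaneChain

/-! ### Central limit theorem for weighted sums -/

theorem Finset.norm_prod_sub_prod_le {ι R : Type*} [NormedCommRing R] [NormOneClass R]
    (t : Finset ι) (f g : ι → R) (hf : ∀ i, ‖f i‖ ≤ 1) (hg : ∀ i, ‖g i‖ ≤ 1) :
    ‖∏ i ∈ t, f i - ∏ i ∈ t, g i‖ ≤ ∑ i ∈ t, ‖f i - g i‖ := by
  classical
  induction t using Finset.induction_on with
  | empty => simp
  | insert i t hi ih =>
    rw [Finset.prod_insert hi, Finset.prod_insert hi, Finset.sum_insert hi]
    have hp : ‖∏ i ∈ t, f i‖ ≤ 1 :=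
      (Finset.norm_prod_le t f).trans (Finset.prod_le_one (fun _ _ => norm_nonneg _) fun i _ => hf i)
    calc ‖f i * ∏ i ∈ t, f i - g i * ∏ i ∈ t, g i‖
        = ‖(f i - g i) * ∏ i ∈ t, f i + g i * (∏ i ∈ t, f i - ∏ i ∈ t, g i)‖ := by
          congr 1; ring
      _ ≤ ‖f i - g i‖ * ‖∏ i ∈ t, f i‖ + ‖g i‖ * ‖∏ i ∈ t, f i - ∏ i ∈ t, g i‖ :=
          (norm_add_le _ _).trans (add_le_add (norm_mul_le _ _) (norm_mul_le _ _))
      _ ≤ ‖f i - g i‖ * 1 + 1 * ‖∏ i ∈ t, f i - ∏ i ∈ t, g i‖ := by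
          gcongr
          exact hg i
      _ ≤ _ := by rw [mul_one, one_mul]; gcongr

namespace ProbabilityTheory

/-- The second-order expansion at `0` of the characteristic function of a standardized random
variable, compared with the characteristic function of the standard normal distribution. -/
theorem charFun_sub_exp_isLittleO {Ω : Type*} [MeasurableSpace Ω] {P : Measure Ω}
    [IsProbabilityMeasure P] {X : Ω → ℝ} (hX : AEMeasurable X P) (h0 : P[X] = 0)
    (h1 : P[X ^ 2] = 1) :
    (fun t : ℝ => charFun (P.map X) t - charFun (gaussianReal 0 1) t) =o[𝓝 0]
      fun t : ℝ => t ^ 2 := by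
  -- The Gaussian has the same first two moments, hence the same expansion.
  have hg := taylor_charFun_two (P := gaussianReal 0 1) (X := id) aemeasurable_id
    (by simp) (by
      have := variance_of_integral_eq_zero (μ := gaussianReal 0 1) (X := id) aemeasurable_id
        (by simp)
      rw [variance_id_gaussianReal] at this
      simpa using this.symm)
  rw [Measure.map_id] at hg
  refine ((taylor_charFun_two hX h0 h1).sub hg).congr_left fun t => ?_
  ring

/-- **Central limit theorem** for weighted sums of independent, identically distributed,
standardized random variables whose weights are normalized and uniformly small, on the level of
characteristic functions. -/
theorem tendsto_charFun_weighted_sum {Ω : Type*} [MeasurableSpace Ω] {P : Measure Ω}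
    [IsProbabilityMeasure P] {X : ℕ → Ω → ℝ} (hindep : iIndepFun X P)
    (hident : ∀ k, IdentDistrib (X k) (X 0) P P) (h0 : P[X 0] = 0) (h1 : P[X 0 ^ 2] = 1)
    (w : ℕ → ℕ → ℝ) (hw : ∀ᶠ n in atTop, ∑ k ∈ Finset.range n, w n k ^ 2 = 1)
    (hsmall : ∀ ε > 0, ∀ᶠ n in atTop, ∀ k < n, |w n k| ≤ ε) (t : ℝ) :
    Tendsto (fun n => charFun (P.map fun ω => ∑ k ∈ Finset.range n, w n k * X k ω) t) atTop
      (𝓝 (charFun (gaussianReal 0 1) t)) := by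
  have mX : ∀ k, AEMeasurable (X k) P := fun k => (hident k).aemeasurable_fst
  have hprod : ∀ n, charFun (P.map fun ω => ∑ k ∈ Finset.range n, w n k * X k ω) t =
      ∏ k ∈ Finset.range n, charFun (P.map (X 0)) (w n k * t) := by
    intro n
    have hi : iIndepFun (fun k ω => w n k * X k ω) P :=
      hindep.comp (fun k x => w n k * x) (fun k => by fun_prop)
    rw [(hi.restrict (Finset.range n)).charFun_map_fun_finsetSum_eq_prod
      (fun k _ => (mX k).const_mul _), Finset.prod_apply]
    refine Finset.prod_congr rfl fun k _ => ?_
    rw [charFun_map_mul_comp (mX k), (hident k).map_eq]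
  -- As the squared weights sum to 1, the Gaussian factorizes along the same weights.
  have hgauss : ∀ n, ∑ k ∈ Finset.range n, w n k ^ 2 = 1 →
      charFun (gaussianReal 0 1) t =
        ∏ k ∈ Finset.range n, charFun (gaussianReal 0 1) (w n k * t) := by
    intro n hn
    simp only [charFun_gaussianReal]
    rw [← Complex.exp_sum]
    congr 1
    have hn' : (∑ k ∈ Finset.range n, (w n k : ℂ) ^ 2) = 1 := by exact_mod_cast hn
    calc _ = (∑ k ∈ Finset.range n, (w n k : ℂ) ^ 2) * (-(t : ℂ) ^ 2 / 2) := by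
          rw [hn']; simp; ring
      _ = _ := by
          rw [Finset.sum_mul]
          refine Finset.sum_congr rfl fun k _ => ?_
          simp
          ring
  rw [Metric.tendsto_atTop']
  intro ε hε
  -- The errors add up to this constant times `t ^ 2`; the `+ 1` covers `t = 0`.
  have hδ : 0 < ε / (2 * (t ^ 2 + 1)) := by positivity
  have hlo := (charFun_sub_exp_isLittleO (mX 0) h0 h1).def hδ
  obtain ⟨r, hr, hball⟩ := Metric.eventually_nhds_iff.1 hlo
  have hr' : 0 < r / (2 * (|t| + 1)) := by positivity
  obtain ⟨N, hN⟩ := eventually_atTop.1 (hw.and (hsmall _ hr'))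
  refine ⟨N, fun n hn => ?_⟩
  obtain ⟨hn1, hn2⟩ := hN n hn.le
  have : IsProbabilityMeasure (P.map (X 0)) := Measure.isProbabilityMeasure_map (mX 0)
  rw [hprod, hgauss n hn1, dist_eq_norm]
  calc _ ≤ ∑ k ∈ Finset.range n, ‖charFun (P.map (X 0)) (w n k * t) -
          charFun (gaussianReal 0 1) (w n k * t)‖ :=
        Finset.norm_prod_sub_prod_le _ _ _ (fun k => norm_charFun_le_one _)
          (fun k => norm_charFun_le_one _)
    _ ≤ ∑ k ∈ Finset.range n, ε / (2 * (t ^ 2 + 1)) * (w n k ^ 2 * t ^ 2) := by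
        refine Finset.sum_le_sum fun k hk => ?_
        have hd : dist (w n k * t) 0 < r := by
          rw [Real.dist_eq, sub_zero, abs_mul]
          calc |w n k| * |t| ≤ r / (2 * (|t| + 1)) * (|t| + 1) := by
                gcongr
                · exact hn2 k (by simpa using hk)
                · linarith
            _ = r / 2 := by field_simp
            _ < r := by linarith
        have := hball hd
        rwa [Real.norm_of_nonneg (sq_nonneg _), mul_pow] at this
    _ = ε / (2 * (t ^ 2 + 1)) * t ^ 2 := by
        rw [← Finset.mul_sum, ← Finset.sum_mul, hn1, one_mul]
    _ < ε := by
        rw [div_mul_eq_mul_div, div_lt_iff₀ (by positivity)]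
        nlinarith [sq_nonneg t]

/-! ### Uniform convergence of distribution functions -/

/-- A finite set of points that resolves a continuous cumulative distribution function up to
`ε`. -/
theorem exists_finset_cdf_resolution {F : ℝ → ℝ} (hF : Continuous F) (hmono : Monotone F)
    (hbot : Tendsto F atBot (𝓝 0)) (htop : Tendsto F atTop (𝓝 1)) {ε : ℝ} (hε : 0 < ε) :
    ∃ T : Finset ℝ, ∀ a, (F a ≤ ε ∨ ∃ x ∈ T, x ≤ a ∧ F a ≤ F x + ε) ∧
      (1 - ε ≤ F a ∨ ∃ y ∈ T, a ≤ y ∧ F y ≤ F a + ε) := by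
  obtain ⟨N, hN⟩ := exists_nat_gt (1 / ε)
  have hNpos : (0 : ℝ) < N := (by positivity : (0 : ℝ) < 1 / ε).trans hN
  have hNε : 1 / (N : ℝ) ≤ ε := by
    rw [div_le_iff₀ hNpos]
    rw [div_lt_iff₀ hε] at hN
    linarith
  have hivt : ∀ c : ℝ, 0 < c → c < 1 → ∃ x, F x = c := by
    intro c h0 h1
    obtain ⟨x, hx⟩ := (hbot.eventually (gt_mem_nhds h0)).exists
    obtain ⟨y, hy⟩ := (htop.eventually (lt_mem_nhds h1)).exists
    exact mem_range_of_exists_le_of_exists_ge hF ⟨x, hx.le⟩ ⟨y, hy.le⟩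
  -- The grid consists of points where `F = i / N`; the values 0 and 1 need not be attained, so
  -- those indices are left free.
  have hpt : ∀ i : ℕ, ∃ x, 0 < i → i < N → F x = i / N := by
    intro i
    by_cases h : 0 < i ∧ i < N
    · obtain ⟨x, hx⟩ := hivt (i / N) (div_pos (by exact_mod_cast h.1) hNpos)
        ((div_lt_one hNpos).2 (by exact_mod_cast h.2))
      exact ⟨x, fun _ _ => hx⟩
    · exact ⟨0, fun h1 h2 => absurd ⟨h1, h2⟩ h⟩
  choose x hx using hpt
  have hF1 : ∀ a, F a ≤ 1 := hmono.ge_of_tendsto htop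
  have hF0 : ∀ a, 0 ≤ F a := hmono.le_of_tendsto hbot
  refine ⟨(Finset.range N).image x, fun a => ⟨?_, ?_⟩⟩
  · by_cases ha : F a ≤ ε
    · exact .inl ha
    right
    -- This `i` is the largest with `i / N < F a`; strictness forces `x i ≤ a`.
    obtain ⟨i, hi⟩ : ∃ i, ⌈F a * N⌉₊ = i + 1 := by
      have : 0 < ⌈F a * N⌉₊ := Nat.ceil_pos.2 (mul_pos (by linarith) hNpos)
      exact ⟨_, (Nat.succ_pred_eq_of_pos this).symm⟩
    have h1 : F a * N ≤ i + 1 := by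
      have := Nat.le_ceil (F a * N)
      rw [hi] at this
      exact_mod_cast this
    have h2 : (i : ℝ) < F a * N := by
      apply Nat.lt_ceil.1
      omega
    have h3 : i < N := by
      have : (i : ℝ) < N := h2.trans_le (by nlinarith [hF1 a])
      exact_mod_cast this
    have h4 : 0 < i := by
      rcases Nat.eq_zero_or_pos i with rfl | h
      · exfalso
        apply ha
        refine le_trans ?_ hNε
        rw [le_div_iff₀ hNpos]
        simpa using h1
      · exact h
    have e := hx i h4 h3
    refine ⟨x i, Finset.mem_image_of_mem _ (by simpa using h3), ?_, ?_⟩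
    · by_contra! hlt
      have := hmono hlt.le
      rw [e, le_div_iff₀ hNpos] at this
      linarith
    · have : F a ≤ (i + 1) / N := by rwa [le_div_iff₀ hNpos]
      rw [add_div] at this
      linarith
  · by_cases ha : 1 - ε ≤ F a
    · exact .inl ha
    right
    have h1 : F a * N < (⌊F a * N⌋₊ + 1 : ℕ) := by
      push_cast
      exact Nat.lt_floor_add_one _
    have h2 : ((⌊F a * N⌋₊ : ℕ) : ℝ) ≤ F a * N := Nat.floor_le (mul_nonneg (hF0 a) hNpos.le)
    have h3 : ⌊F a * N⌋₊ + 1 < N := by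
      have : ((⌊F a * N⌋₊ : ℕ) : ℝ) + 1 < N := by
        have hNε' : 1 ≤ ε * N := by rwa [div_le_iff₀ hNpos] at hNε
        nlinarith
      exact_mod_cast this
    have e := hx _ (Nat.succ_pos _) h3
    refine ⟨x (⌊F a * N⌋₊ + 1), Finset.mem_image_of_mem _ (by simpa using h3), ?_, ?_⟩
    · by_contra! hlt
      have := hmono hlt.le
      rw [e, div_le_iff₀ hNpos] at this
      linarith
    · rw [e]
      push_cast
      rw [add_div]
      have : (⌊F a * N⌋₊ : ℝ) / N ≤ F a := by rwa [div_le_iff₀ hNpos]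
      linarith

/-- **Pólya's theorem**: cumulative distribution functions that converge pointwise to a continuous
cumulative distribution function converge uniformly. -/
theorem tendsto_iSup_abs_sub_of_tendsto {G : ℕ → ℝ → ℝ} {F : ℝ → ℝ} (hF : Continuous F)
    (hmono : Monotone F) (hbot : Tendsto F atBot (𝓝 0)) (htop : Tendsto F atTop (𝓝 1))
    (hG : ∀ᶠ n in atTop, Monotone (G n)) (hG0 : ∀ᶠ n in atTop, ∀ a, 0 ≤ G n a)
    (hG1 : ∀ᶠ n in atTop, ∀ a, G n a ≤ 1) (h : ∀ a, Tendsto (fun n => G n a) atTop (𝓝 (F a))) :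
    Tendsto (fun n => ⨆ a, |G n a - F a|) atTop (𝓝 0) := by
  rw [Metric.tendsto_atTop']
  intro ε hε
  obtain ⟨T, hT⟩ := exists_finset_cdf_resolution hF hmono hbot htop
    (show 0 < ε / 4 by positivity)
  have hclose : ∀ᶠ n in atTop, ∀ x ∈ T, |G n x - F x| < ε / 4 := by
    rw [Filter.eventually_all_finset]
    intro x _
    have := (Metric.tendsto_nhds.1 (h x)) (ε / 4) (by positivity)
    simpa [Real.dist_eq] using this
  obtain ⟨N, hN⟩ := eventually_atTop.1 (hclose.and (hG.and (hG0.and hG1)))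
  refine ⟨N, fun n hn => ?_⟩
  obtain ⟨hc, hm, h0, h1⟩ := hN n hn.le
  have hF1 : ∀ a, F a ≤ 1 := hmono.ge_of_tendsto htop
  have hF0 : ∀ a, 0 ≤ F a := hmono.le_of_tendsto hbot
  have hb : ∀ a, |G n a - F a| ≤ ε / 2 := by
    intro a
    obtain ⟨hl, hu⟩ := hT a
    rw [abs_le]
    constructor
    · rcases hl with hl | ⟨x, hx, hxa, hl⟩
      · linarith [h0 a]
      · have := (abs_lt.1 (hc x hx)).1
        linarith [hm hxa]
    · rcases hu with hu | ⟨y, hy, hya, hu⟩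
      · linarith [h1 a]
      · have := (abs_lt.1 (hc y hy)).2
        linarith [hm hya]
  rw [Real.dist_eq, sub_zero, abs_of_nonneg (Real.iSup_nonneg fun a => abs_nonneg _)]
  exact (ciSup_le hb).trans_lt (by linarith)

/-- Random variables whose characteristic functions converge pointwise to that of the standard
normal distribution have distribution functions that converge uniformly to that of the standard
normal distribution. -/
theorem tendsto_iSup_abs_cdf_sub_gaussian {Ω : Type*} [MeasurableSpace Ω] {P : Measure Ω}
    [IsProbabilityMeasure P] {Y : ℕ → Ω → ℝ} (hY : ∀ n, AEMeasurable (Y n) P)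
    (h : ∀ t, Tendsto (fun n => charFun (P.map (Y n)) t) atTop
      (𝓝 (charFun (gaussianReal 0 1) t))) :
    Tendsto (fun n => ⨆ a : ℝ, |P.real {ω | Y n ω ≤ a} -
      ∫ t in Set.Iic a, 1 / Real.sqrt (2 * Real.pi) * Real.exp (-(t ^ 2) / 2)|) atTop (𝓝 0) := by
  have hgauss : ∀ a, ∫ t in Set.Iic a, 1 / Real.sqrt (2 * Real.pi) * Real.exp (-(t ^ 2) / 2) =
      cdf (gaussianReal 0 1) a := by
    intro a
    rw [cdf_eq_real, measureReal_def, gaussianReal_apply_eq_integral 0 one_ne_zero,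
      ENNReal.toReal_ofReal (integral_nonneg fun t => gaussianPDFReal_nonneg _ _ _)]
    simp [gaussianPDFReal_def]
  simp only [hgauss]
  have hatom : NullSingletonClass (gaussianReal 0 1) :=
    nullSingletonClass_gaussianReal one_ne_zero
  -- A distribution function is right-continuous, and its jump at `x` is the mass of `{x}`, here 0.
  have hcont : Continuous (cdf (gaussianReal 0 1)) := by
    rw [continuous_iff_continuousAt]
    intro x
    rw [(monotone_cdf _).continuousAt_iff_leftLim_eq_rightLim, StieltjesFunction.rightLim_eq]
    have hs := StieltjesFunction.measure_singleton (cdf (gaussianReal 0 1)) x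
    rw [measure_cdf, measure_singleton] at hs
    have h1 := ENNReal.ofReal_eq_zero.1 hs.symm
    have h2 := (monotone_cdf (gaussianReal 0 1)).leftLim_le (le_refl x)
    linarith
  refine tendsto_iSup_abs_sub_of_tendsto hcont (monotone_cdf _) (tendsto_cdf_atBot _)
    (tendsto_cdf_atTop _) (.of_forall fun n a b hab => ?_)
    (.of_forall fun n a => measureReal_nonneg) (.of_forall fun n a => measureReal_le_one)
    fun a => ?_
  · exact measureReal_mono fun ω (hω : Y n ω ≤ a) => hω.trans hab
  · have hprob : ∀ n, IsProbabilityMeasure (P.map (Y n)) :=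
      fun n => Measure.isProbabilityMeasure_map (hY n)
    let μ : ℕ → ProbabilityMeasure ℝ := fun n => ⟨P.map (Y n), hprob n⟩
    let μ₀ : ProbabilityMeasure ℝ := ⟨gaussianReal 0 1, inferInstance⟩
    -- Lévy's continuity theorem, then the portmanteau theorem: the frontier of `Iic a` is a null
    -- set.
    have hweak : Tendsto μ atTop (𝓝 μ₀) := ProbabilityMeasure.tendsto_of_tendsto_charFun h
    have := ProbabilityMeasure.tendsto_measure_of_null_frontier_of_tendsto' hweak
      (E := Set.Iic a) (by simp [μ₀])
    have h2 := (ENNReal.tendsto_toReal (measure_ne_top (gaussianReal 0 1) _)).comp this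
    rw [cdf_eq_real]
    refine h2.congr fun n => ?_
    simp only [Function.comp_apply, μ, ProbabilityMeasure.coe_mk]
    rw [Measure.map_apply_of_aemeasurable (hY n) measurableSet_Iic]
    rfl

end ProbabilityTheory

/-! ### The law of the attaching distances -/

namespace CyclooctaneChain

/-- Exactly one indicator is 1, and its index gives the distance. So every function of the distance
is linear in the indicators, and its expectation depends only on `p`; real values give moments,
complex ones the characteristic function. -/
theorem comp_cycDist_eq_sum {E : Type*} [AddCommGroup E] [Module ℝ E] (f : ℝ → E) {a : Fin 8}
    (ha : a ≠ 0) :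
    f (cycDist 0 a) = ∑ i : Fin 4, choiceIndicator a i • f ((i : ℕ) + 1) := by
  have h : ∀ a : Fin 8, a ≠ 0 → ∃ i : Fin 4, cycDist 0 a = i + 1 ∧
      ∀ j, a ∈ attachingSites j ↔ j = i := by
    decide
  obtain ⟨i, hi, hj⟩ := h a ha
  rw [Finset.sum_eq_single i]
  · simp [choiceIndicator, hj, hi]
  · intro j _ hne
    simp [choiceIndicator, hj, hne]
  · simp

namespace IsRandomChain

variable {Ω : Type*} [MeasurableSpace Ω] {P : Measure Ω} {s : ℕ → Ω → Fin 8} {p : Fin 4 → ℝ}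

/-- Only the indicator vectors, not the sites, are assumed measurable and independent; this formula
transfers both properties. -/
theorem siteDist_eq (hs : IsRandomChain P s p) (k : ℕ) (ω : Ω) :
    siteDist (fun m => s m ω) (k + 1) =
      ∑ i : Fin 4, choiceIndicator (s (k + 2) ω) i * (((i : ℕ) : ℝ) + 1) :=
  comp_cycDist_eq_sum (fun x => x) (hs.site_ne (k + 2) (by omega) ω)

theorem measurable_siteDist (hs : IsRandomChain P s p) (k : ℕ) :
    Measurable fun ω => siteDist (fun m => s m ω) (k + 1) := by
  simp only [hs.siteDist_eq]
  have := measurable_pi_iff.1 (hs.measurable_choice (k + 2) (by omega))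
  fun_prop

theorem iIndepFun_siteDist (hs : IsRandomChain P s p) :
    iIndepFun (fun (k : ℕ) ω => siteDist (fun m => s m ω) (k + 1)) P := by
  simp only [hs.siteDist_eq]
  exact hs.indep.comp (fun _ z => ∑ i : Fin 4, z i * (((i : ℕ) : ℝ) + 1)) fun _ => by fun_prop

variable [IsProbabilityMeasure P]

theorem integral_choiceIndicator (hs : IsRandomChain P s p) (k : ℕ) (i : Fin 4) :
    Integrable (fun ω => choiceIndicator (s (k + 2) ω) i) P ∧
      ∫ ω, choiceIndicator (s (k + 2) ω) i ∂P = p i := by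
  have hm := measurable_pi_iff.1 (hs.measurable_choice (k + 2) (by omega)) i
  have e : (fun ω => choiceIndicator (s (k + 2) ω) i) =
      Set.indicator {ω | choiceIndicator (s (k + 2) ω) i = 1} 1 := by
    ext ω
    by_cases h : s (k + 2) ω ∈ attachingSites i <;> simp [Set.indicator, choiceIndicator, h]
  have hset : MeasurableSet {ω | choiceIndicator (s (k + 2) ω) i = 1} :=
    hm (measurableSet_singleton 1)
  refine ⟨?_, ?_⟩
  · rw [e]
    exact (integrable_const (1 : ℝ)).indicator hset
  · rw [e, integral_indicator_one hset, hs.prob_one _ (by omega)]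

theorem integral_comp_siteDist {E : Type*} [NormedAddCommGroup E] [NormedSpace ℝ E]
    [CompleteSpace E] (hs : IsRandomChain P s p) (k : ℕ) (f : ℝ → E) :
    ∫ ω, f (siteDist (fun m => s m ω) (k + 1)) ∂P = ∑ i, p i • f ((i : ℕ) + 1) := by
  have e : ∀ ω, f (siteDist (fun m => s m ω) (k + 1)) =
      ∑ i : Fin 4, choiceIndicator (s (k + 2) ω) i • f ((i : ℕ) + 1) := fun ω =>
    comp_cycDist_eq_sum f (hs.site_ne (k + 2) (by omega) ω)
  simp only [e]
  rw [integral_finsetSum _ fun i _ => (hs.integral_choiceIndicator k i).1.smul_const _]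
  refine Finset.sum_congr rfl fun i _ => ?_
  rw [integral_smul_const, (hs.integral_choiceIndicator k i).2]

theorem identDistrib_siteDist (hs : IsRandomChain P s p) (k l : ℕ) :
    IdentDistrib (fun ω => siteDist (fun m => s m ω) (k + 1))
      (fun ω => siteDist (fun m => s m ω) (l + 1)) P P where
  aemeasurable_fst := (hs.measurable_siteDist k).aemeasurable
  aemeasurable_snd := (hs.measurable_siteDist l).aemeasurable
  map_eq := by
    have := Measure.isProbabilityMeasure_map (μ := P) (hs.measurable_siteDist k).aemeasurable
    have := Measure.isProbabilityMeasure_map (μ := P) (hs.measurable_siteDist l).aemeasurable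
    refine Measure.ext_of_charFun (funext fun t => ?_)
    simp only [charFun_apply_real]
    rw [integral_map (hs.measurable_siteDist k).aemeasurable (by fun_prop),
      integral_map (hs.measurable_siteDist l).aemeasurable (by fun_prop),
      hs.integral_comp_siteDist k fun x : ℝ => Complex.exp (t * x * Complex.I),
      hs.integral_comp_siteDist l fun x : ℝ => Complex.exp (t * x * Complex.I)]

theorem memLp_siteDist (hs : IsRandomChain P s p) (k : ℕ) (q : ENNReal) :
    MemLp (fun ω => siteDist (fun m => s m ω) (k + 1)) q P := by
  refine MemLp.of_bound (hs.measurable_siteDist k).aestronglyMeasurable 8 (.of_forall fun ω => ?_)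
  have h : ∀ a, cycDist 0 a ≤ 8 := by decide
  rw [siteDist, Real.norm_of_nonneg (Nat.cast_nonneg _)]
  exact_mod_cast h _

end IsRandomChain

/-! ### Size of the weights -/

/-- The weight of the attaching distance of the octagon with index `k + 1` in the Schultz index of
the chain with `N + 1` octagons. -/
def siteWeight (N k : ℕ) : ℝ := 288 * (((k : ℝ) + 1) * ((N : ℝ) - 1 - k))

theorem sum_siteWeight_sq (N : ℕ) :
    ∑ k ∈ Finset.range N, siteWeight N k ^ 2 =
      288 ^ 2 / 30 * (N * ((N : ℝ) ^ 2 - 1) * ((N : ℝ) ^ 2 + 1)) := by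
  -- The parameter in the summand is separated from the range so that induction on `n` applies.
  have h : ∀ (M : ℝ) (n : ℕ), ∑ k ∈ Finset.range n, (288 * (((k : ℝ) + 1) * (M - 1 - k))) ^ 2 =
      288 ^ 2 * (M ^ 2 * (n * (n + 1) * (2 * n + 1)) / 6 - M * (n * (n + 1)) ^ 2 / 2 +
        n * (n + 1) * (2 * n + 1) * (3 * (n : ℝ) ^ 2 + 3 * n - 1) / 30) := by
    intro M n
    induction n with
    | zero => simp
    | succ n ih =>
      rw [Finset.sum_range_succ, ih]
      push_cast
      ring
  simp only [siteWeight]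
  rw [h]
  ring

theorem siteWeight_sq_le {N k : ℕ} (h : k < N) : siteWeight N k ^ 2 ≤ 288 ^ 2 * (N : ℝ) ^ 4 := by
  have h1 : (k : ℝ) + 1 ≤ N := by exact_mod_cast h
  have h2 : (0 : ℝ) ≤ k := Nat.cast_nonneg k
  have h3 : 0 ≤ (N : ℝ) - 1 - k := by linarith
  have h4 : ((k : ℝ) + 1) * ((N : ℝ) - 1 - k) ≤ N * N := by
    apply mul_le_mul h1 _ h3 (Nat.cast_nonneg N)
    linarith
  have h5 : 0 ≤ ((k : ℝ) + 1) * ((N : ℝ) - 1 - k) := mul_nonneg (by linarith) h3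
  calc siteWeight N k ^ 2 = 288 ^ 2 * (((k : ℝ) + 1) * ((N : ℝ) - 1 - k)) ^ 2 := by
        rw [siteWeight]; ring
    _ ≤ 288 ^ 2 * ((N : ℝ) * N) ^ 2 := by gcongr
    _ = _ := by ring

theorem sum_siteWeight_sq_ge {N : ℕ} (h : 2 ≤ N) :
    288 ^ 2 / 60 * (N : ℝ) ^ 5 ≤ ∑ k ∈ Finset.range N, siteWeight N k ^ 2 := by
  rw [sum_siteWeight_sq]
  have hN : (2 : ℝ) ≤ N := by exact_mod_cast h
  have h4 : (2 : ℝ) ≤ (N : ℝ) ^ 4 := by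
    calc (2 : ℝ) ≤ 2 ^ 4 := by norm_num
      _ ≤ (N : ℝ) ^ 4 := by gcongr
  nlinarith [mul_le_mul_of_nonneg_left h4 (show (0 : ℝ) ≤ N by linarith)]

/-- The square of the ratio is at most `288² N⁴ / (288² N⁵ / 60) = 60 / N`. -/
theorem eventually_abs_siteWeight_div_le {ε : ℝ} (hε : 0 < ε) :
    ∀ᶠ N : ℕ in atTop, ∀ k < N,
      |siteWeight N k / √(∑ l ∈ Finset.range N, siteWeight N l ^ 2)| ≤ ε := by
  obtain ⟨M, hM⟩ := exists_nat_gt (60 / ε ^ 2)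
  filter_upwards [eventually_ge_atTop (max M 2)] with N hN k hk
  have hN2 : 2 ≤ N := le_trans (le_max_right _ _) hN
  have hNM : (M : ℝ) ≤ N := by exact_mod_cast le_trans (le_max_left _ _) hN
  have hNpos : (0 : ℝ) < N := by
    have : (2 : ℝ) ≤ N := by exact_mod_cast hN2
    linarith
  have hge := sum_siteWeight_sq_ge hN2
  have hpos : 0 < ∑ l ∈ Finset.range N, siteWeight N l ^ 2 :=
    lt_of_lt_of_le (by positivity) hge
  refine abs_le_of_sq_le_sq ?_ hε.le
  rw [div_pow, Real.sq_sqrt hpos.le, div_le_iff₀ hpos]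
  have h60 : 60 ≤ ε ^ 2 * N := by
    rw [div_lt_iff₀ (by positivity)] at hM
    nlinarith [sq_nonneg ε, mul_le_mul_of_nonneg_left hNM (sq_nonneg ε)]
  calc siteWeight N k ^ 2 ≤ 288 ^ 2 * (N : ℝ) ^ 4 := siteWeight_sq_le hk
    _ = 60 * (288 ^ 2 / 60 * (N : ℝ) ^ 4) := by ring
    _ ≤ ε ^ 2 * N * (288 ^ 2 / 60 * (N : ℝ) ^ 4) := by gcongr
    _ = ε ^ 2 * (288 ^ 2 / 60 * (N : ℝ) ^ 5) := by ring
    _ ≤ _ := by gcongr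

theorem schultzChain_eq {Ω : Type*} (s : ℕ → Ω → Fin 8) (N : ℕ) (ω : Ω) :
    schultzChain s (N + 1) ω = schultzConst (N + 1) +
      ∑ k ∈ Finset.range N, siteWeight N k * siteDist (fun m => s m ω) (k + 1) :=
  schultzIndex_chain N fun m => s m ω

theorem IsRandomChain.measurable_schultzChain {Ω : Type*} [MeasurableSpace Ω] {P : Measure Ω}
    {s : ℕ → Ω → Fin 8} {p : Fin 4 → ℝ} (hs : IsRandomChain P s p) (N : ℕ) :
    Measurable (schultzChain s (N + 1)) := by
  have h := hs.measurable_siteDist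
  have e : schultzChain s (N + 1) = fun ω => schultzConst (N + 1) +
      ∑ k ∈ Finset.range N, siteWeight N k * siteDist (fun m => s m ω) (k + 1) :=
    funext (schultzChain_eq s N)
  rw [e]
  fun_prop

/-! ### Moments and asymptotic normality of the random index -/

/-- The mean of the distance between the attaching vertices of an octagon. -/
def siteMean (p : Fin 4 → ℝ) : ℝ := ∑ i, p i * (((i : ℕ) : ℝ) + 1)

/-- The variance of the distance between the attaching vertices of an octagon. -/
def siteVar (p : Fin 4 → ℝ) : ℝ := ∑ i, p i * (((i : ℕ) : ℝ) + 1 - siteMean p) ^ 2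

/-- The distances 1 and 2 both have positive probability, and the mean differs from at least one of
them. -/
theorem siteVar_pos {p : Fin 4 → ℝ} (hp : ∀ i, 0 < p i) : 0 < siteVar p := by
  have hnonneg : ∀ i ∈ Finset.univ, 0 ≤ p i * (((i : ℕ) : ℝ) + 1 - siteMean p) ^ 2 :=
    fun i _ => mul_nonneg (hp i).le (sq_nonneg _)
  by_cases h : siteMean p = 1
  · refine Finset.sum_pos' hnonneg ⟨1, Finset.mem_univ _, mul_pos (hp 1) ?_⟩
    rw [h]
    norm_num
  · refine Finset.sum_pos' hnonneg ⟨0, Finset.mem_univ _, mul_pos (hp 0) ?_⟩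
    have : ((0 : Fin 4) : ℕ) = 0 := rfl
    rw [this, Nat.cast_zero, zero_add]
    exact sq_pos_of_ne_zero (sub_ne_zero.2 (Ne.symm h))

namespace IsRandomChain

variable {Ω : Type*} [MeasurableSpace Ω] {P : Measure Ω} [IsProbabilityMeasure P]
  {s : ℕ → Ω → Fin 8} {p : Fin 4 → ℝ}

theorem integral_siteDist (hs : IsRandomChain P s p) (k : ℕ) :
    ∫ ω, siteDist (fun m => s m ω) (k + 1) ∂P = siteMean p :=
  hs.integral_comp_siteDist k fun x => x

theorem integral_siteDist_sub_sq (hs : IsRandomChain P s p) (k : ℕ) :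
    ∫ ω, (siteDist (fun m => s m ω) (k + 1) - siteMean p) ^ 2 ∂P = siteVar p :=
  hs.integral_comp_siteDist k fun x => (x - siteMean p) ^ 2

theorem variance_siteDist (hs : IsRandomChain P s p) (k : ℕ) :
    variance (fun ω => siteDist (fun m => s m ω) (k + 1)) P = siteVar p := by
  rw [variance_eq_integral (hs.measurable_siteDist k).aemeasurable, hs.integral_siteDist,
    hs.integral_siteDist_sub_sq]

theorem memLp_schultzChain (hs : IsRandomChain P s p) (N : ℕ) :
    MemLp (schultzChain s (N + 1)) 2 P := by
  have e : schultzChain s (N + 1) = fun ω => schultzConst (N + 1) +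
      ∑ k ∈ Finset.range N, siteWeight N k * siteDist (fun m => s m ω) (k + 1) :=
    funext (schultzChain_eq s N)
  rw [e]
  have h : MemLp (fun ω => ∑ k ∈ Finset.range N,
      siteWeight N k * siteDist (fun m => s m ω) (k + 1)) 2 P :=
    memLp_finsetSum _ fun k _ => (hs.memLp_siteDist k 2).const_mul _
  exact (memLp_const (schultzConst (N + 1))).add h

theorem integral_schultzChain (hs : IsRandomChain P s p) (N : ℕ) :
    ∫ ω, schultzChain s (N + 1) ω ∂P =
      schultzConst (N + 1) + ∑ k ∈ Finset.range N, siteWeight N k * siteMean p := by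
  have hint : ∀ k ∈ Finset.range N,
      Integrable (fun ω => siteWeight N k * siteDist (fun m => s m ω) (k + 1)) P := fun k _ =>
    ((hs.memLp_siteDist k 1).integrable le_rfl).const_mul _
  simp only [schultzChain_eq]
  rw [integral_add (integrable_const _) (integrable_finsetSum _ hint),
    integral_finsetSum _ hint]
  simp [integral_const_mul, hs.integral_siteDist]

theorem variance_schultzChain (hs : IsRandomChain P s p) (N : ℕ) :
    variance (schultzChain s (N + 1)) P =
      (∑ k ∈ Finset.range N, siteWeight N k ^ 2) * siteVar p := by
  have e : schultzChain s (N + 1) = fun ω => schultzConst (N + 1) +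
      (∑ k ∈ Finset.range N, fun ω => siteWeight N k * siteDist (fun m => s m ω) (k + 1)) ω := by
    ext ω
    rw [schultzChain_eq, Finset.sum_apply]
  have hmem : ∀ k ∈ Finset.range N,
      MemLp (fun ω => siteWeight N k * siteDist (fun m => s m ω) (k + 1)) 2 P := fun k _ =>
    (hs.memLp_siteDist k 2).const_mul _
  have hind : iIndepFun (fun k ω => siteWeight N k * siteDist (fun m => s m ω) (k + 1)) P :=
    hs.iIndepFun_siteDist.comp (fun k x => siteWeight N k * x) fun k => by fun_prop
  rw [e, variance_const_add (memLp_finsetSum' _ hmem).aestronglyMeasurable,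
    IndepFun.variance_sum hmem fun i _ j _ hij => hind.indepFun hij, Finset.sum_mul]
  refine Finset.sum_congr rfl fun k _ => ?_
  rw [variance_const_mul, hs.variance_siteDist]

theorem tendsto_iSup_abs_cdf_schultzChain_sub_gaussian (hs : IsRandomChain P s p)
    (hp : 0 < siteVar p) :
    Tendsto
      (fun n : ℕ => ⨆ a : ℝ,
        |P.real {ω | (schultzChain s n ω - ∫ ω', schultzChain s n ω' ∂P)
              / Real.sqrt (variance (schultzChain s n) P) ≤ a}
          - ∫ t in Set.Iic a, 1 / Real.sqrt (2 * Real.pi) * Real.exp (-(t ^ 2) / 2)|)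
      atTop (𝓝 0) := by
  rw [← tendsto_add_atTop_iff_nat 1]
  have hY : ∀ N ω, (schultzChain s (N + 1) ω - ∫ ω', schultzChain s (N + 1) ω' ∂P)
      / Real.sqrt (variance (schultzChain s (N + 1)) P) =
      ∑ k ∈ Finset.range N, siteWeight N k / √(∑ l ∈ Finset.range N, siteWeight N l ^ 2) *
        ((siteDist (fun m => s m ω) (k + 1) - siteMean p) / √(siteVar p)) := by
    intro N ω
    rw [hs.variance_schultzChain, hs.integral_schultzChain, schultzChain_eq,
      Real.sqrt_mul (Finset.sum_nonneg fun _ _ => sq_nonneg _), add_sub_add_left_eq_sub,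
      ← Finset.sum_sub_distrib, Finset.sum_div]
    refine Finset.sum_congr rfl fun k _ => ?_
    rw [← mul_sub, mul_div_mul_comm]
  refine tendsto_iSup_abs_cdf_sub_gaussian
    (Y := fun N ω => (schultzChain s (N + 1) ω - ∫ ω', schultzChain s (N + 1) ω' ∂P)
      / Real.sqrt (variance (schultzChain s (N + 1)) P))
    (fun N => (((hs.measurable_schultzChain N).sub_const _).div_const _).aemeasurable) fun t => ?_
  simp only [hY]
  refine tendsto_charFun_weighted_sum
    (X := fun k ω => (siteDist (fun m => s m ω) (k + 1) - siteMean p) / √(siteVar p))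
    ?_ (fun k => ?_) ?_ ?_
    (fun N k => siteWeight N k / √(∑ l ∈ Finset.range N, siteWeight N l ^ 2)) ?_
    (fun ε hε => eventually_abs_siteWeight_div_le hε) t
  · exact hs.iIndepFun_siteDist.comp (fun _ x => (x - siteMean p) / √(siteVar p))
      fun _ => by fun_prop
  · exact (hs.identDistrib_siteDist k 0).comp (u := fun x => (x - siteMean p) / √(siteVar p))
      (by fun_prop)
  · rw [integral_div, integral_sub ((hs.memLp_siteDist 0 1).integrable le_rfl)
      (integrable_const _), hs.integral_siteDist]
    simp
  · simp only [Pi.pow_apply, div_pow]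
    rw [integral_div, hs.integral_siteDist_sub_sq, Real.sq_sqrt hp.le, div_self hp.ne']
  · filter_upwards [eventually_ge_atTop 2] with N hN
    have hN' : (0 : ℝ) < N := by
      have : (2 : ℝ) ≤ N := by exact_mod_cast hN
      linarith
    have hpos : 0 < ∑ l ∈ Finset.range N, siteWeight N l ^ 2 :=
      lt_of_lt_of_le (by positivity) (sum_siteWeight_sq_ge hN)
    simp only [div_pow]
    rw [← Finset.sum_div, Real.sq_sqrt hpos.le, div_self hpos.ne']

end IsRandomChain

end CyclooctaneChain

theorem theorem3p2 {Ω : Type*} [MeasurableSpace Ω] (P : Measure Ω) [IsProbabilityMeasure P]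
    (p₁ p₂ p₃ : ℝ)
    (hp₁ : 0 < p₁ ∧ p₁ < 1) (hp₂ : 0 < p₂ ∧ p₂ < 1) (hp₃ : 0 < p₃ ∧ p₃ < 1)
    (hp₄ : 0 < 1 - p₁ - p₂ - p₃ ∧ 1 - p₁ - p₂ - p₃ < 1)
    (s : ℕ → Ω → Fin 8)
    (hs : CyclooctaneChain.IsRandomChain P s ![p₁, p₂, p₃, 1 - p₁ - p₂ - p₃]) :
    (∀ n : ℕ, 1 ≤ n →
      Measurable (CyclooctaneChain.schultzChain s n) ∧
      MemLp (CyclooctaneChain.schultzChain s n) 2 P ∧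
      variance (CyclooctaneChain.schultzChain s n) P =
        1 / 30 *
          (CyclooctaneChain.sigmaSq p₁ p₂ p₃ * (n : ℝ) ^ 5
            - 5 * CyclooctaneChain.rConst p₁ p₂ p₃ * (n : ℝ) ^ 4
            + 10 * CyclooctaneChain.sigmaTildeSq p₁ p₂ p₃ * (n : ℝ) ^ 3
            + (65 * CyclooctaneChain.rConst p₁ p₂ p₃ - 30 * CyclooctaneChain.sigmaSq p₁ p₂ p₃
                - 45 * CyclooctaneChain.sigmaTildeSq p₁ p₂ p₃) * (n : ℝ) ^ 2
            + (59 * CyclooctaneChain.sigmaSq p₁ p₂ p₃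
                + 65 * CyclooctaneChain.sigmaTildeSq p₁ p₂ p₃
                - 120 * CyclooctaneChain.rConst p₁ p₂ p₃) * (n : ℝ)
            + (60 * CyclooctaneChain.rConst p₁ p₂ p₃ - 30 * CyclooctaneChain.sigmaSq p₁ p₂ p₃
                - 30 * CyclooctaneChain.sigmaTildeSq p₁ p₂ p₃))) ∧
    Tendsto
      (fun n : ℕ => ⨆ a : ℝ,
        |P.real {ω | (CyclooctaneChain.schultzChain s n ω
              - ∫ ω', CyclooctaneChain.schultzChain s n ω' ∂P)
              / Real.sqrt (variance (CyclooctaneChain.schultzChain s n) P) ≤ a}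
          - ∫ t in Set.Iic a, 1 / Real.sqrt (2 * Real.pi) * Real.exp (-(t ^ 2) / 2)|)
      atTop (𝓝 0) := by
  refine ⟨fun n hn => ?_, hs.tendsto_iSup_abs_cdf_schultzChain_sub_gaussian
    (CyclooctaneChain.siteVar_pos fun i => ?_)⟩
  · obtain ⟨N, rfl⟩ : ∃ N, n = N + 1 := ⟨n - 1, by omega⟩
    refine ⟨hs.measurable_schultzChain N, hs.memLp_schultzChain N, ?_⟩
    -- With `n = N + 1`, and all three constants equal to `288 ^ 2 * siteVar`, both sides are that
    -- constant times `((n - 1) ^ 5 - (n - 1)) / 30`.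
    rw [hs.variance_schultzChain, CyclooctaneChain.sum_siteWeight_sq]
    simp only [CyclooctaneChain.siteVar, CyclooctaneChain.siteMean, Fin.sum_univ_four,
      CyclooctaneChain.sigmaSq, CyclooctaneChain.sigmaTildeSq, CyclooctaneChain.rConst,
      Matrix.cons_val]
    push_cast
    simp only [Fin.isValue, Fin.coe_ofNat_eq_mod, Nat.zero_mod, Nat.reduceMod, Nat.one_mod]
    push_cast
    ring
  · fin_cases i
    · exact hp₁.1
    · exact hp₂.1
    · exact hp₃.1
    · exact hp₄.1
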